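/- Let $Q$ be a group with subgroups $L$, $M$, $P$ such that: (i) $M$ and $P$ are normal in $Q$; (ii) $LM\subseteq P$; (iii) $M$ is a Mal'cev complete nilpotent group of finite Hirsch length, that is, $M$ is nilpotent, for each integer $n\ge 1$ every element of $M$ has exactly one $n$-th root in $M$, and the Hirsch length of $M$ (the sum of the torsion-free ranks of the abelian factors of its derived series) is finite; (iv) either $L=1$ and $P/M$ is nilpotent, or $LM=P$ and $L$ is nilpotent. Then $Q$ has a subgroup $Q_0$ such that $L\subseteq Q_0$, $P\cap Q_0$ is nilpotent, and $Q_0M=Q$. If moreover $Q/M$ and $L$ are finitely generated, then $Q$ has a finitely generated subgroup $Q_0$ with these three properties. -/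

import Mathlib

open scoped Pointwise

/-- The Hirsch length of a solvable group `G`, as an element of `ℕ ∪ {∞}`: the sum of the
torsion-free ranks of the (abelian) factors of the derived series of `G`.  The `i`-th factor is the
abelianization of the `i`-th derived subgroup, and its torsion-free rank is the maximal number of
`ℤ`-linearly independent elements, that is, its rank as a `ℤ`-module. -/
noncomputable def hirschLength (G : Type*) [Group G] : ℕ∞ :=
  Cardinal.toENat
    (Cardinal.sum fun i : ℕ => Module.rank ℤ (Additive (Abelianization (derivedSeries G i))))

/-- A group is Mal'cev complete nilpotent if it is nilpotent and uniquely divisible: for each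
positive integer `n`, every element has exactly one `n`-th root. -/
structure IsMalcevComplete (G : Type*) [Group G] : Prop where
  isNilpotent : Group.IsNilpotent G
  pow_bijective : ∀ n : ℕ, 0 < n → Function.Bijective fun x : G => x ^ n

/-!
Call `V` a rational normal subgroup of `Q` if it is abelian, normal, uniquely divisible and of
finite rank, that is, a finite-dimensional rational vector space on which `Q` acts linearly.

*Reduction to abelian `M`.*  The centre `Z` of `M` is rational: unique roots of central elements are
central, and its rank is bounded by the Hirsch length of `M`.  The quotient `M/Z` is again
Mal'cev complete of finite Hirsch length, and of smaller class.  By induction there is a supplement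
`Q₁/Z` of `M/Z` in `Q/Z`, and it remains to treat `Z` in `Q₁`, where `P ∩ Q₁` is nilpotent modulo
`Z`.  If `P = LM`, then elements of `P` act on `Z` as elements of `L` do; this survives the passage
to `Q₁`, whereas `P ∩ Q₁` need not be `LZ`.

*The abelian case.*  Let `P` be nilpotent modulo the rational subgroup `V`, and let `W ≤ V` be the
part of `V` lying in the hypercentre of `P`.  Then `P` has no nonzero fixed vectors on `V/W`.  A
preimage in `P` of a complement of `V/W` in `P/W` is nilpotent, since `W` is hypercentral.
Complements are conjugate, so by the Frattini argument the normalizer of a complement supplements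
`V/W` in `Q/W`, and it meets `P/W` exactly in the complement
(`IsNormalEmbedding.exists_complement_of_normal`).  A nilpotent `L` without fixed vectors on `V/W`
lies in some complement.

*Splitting and conjugacy.*  These say that the second and first cohomology of a nilpotent group with
coefficients in a finite-dimensional module without fixed vectors vanish.  In degree one
(`exists_eq_coboundary`) take the first term of the upper central series that acts nontrivially,
and an element `z` of it acting nontrivially.  The previous term acts trivially and derivations
vanish on it, so `z - 1` commutes with the action and turns each derivation into an inner one; the kernel and the image of `z - 1` are handled
by induction on the dimension.  For the splitting (`exists_complement`), the terms of the series
that act trivially lift to the upper central series of the extension, because the obstruction is a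
derivation.  Commutation with `z` is then again a derivation, and the kernel of a suitable
modification of it is a supplement which meets the module in the proper subspace `ker (z - 1)`;
repeat inside it.

For the finitely generated version it suffices to take the subgroup generated by `L` and lifts to
the supplement of generators of `Q/M` (`exists_fg_supplement`).
-/

open scoped commutatorElement

universe u v

/-! ### Derivations of nilpotent groups -/

/-- The `n`-th term of the upper central series of `P` relative to `S`: the elements `x` all of
whose iterated commutators `⁅⁅x, p₁⁆, …, pₙ⁆` with `pᵢ ∈ P` lie in `S`.  No subgroup structure is
required, and `x` is not required to lie in `P`; this makes passage to images, preimages and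
subgroups immediate. -/
def relUpperCentral {G : Type*} [Group G] (P S : Set G) : ℕ → Set G
  | 0 => S
  | n + 1 => {x | ∀ p ∈ P, ⁅x, p⁆ ∈ relUpperCentral P S n}

/-- If `G` is nilpotent modulo a set acting trivially on a finite-dimensional `G`-module without
nonzero fixed vectors, then each derivation vanishing on that set, with values in an invariant
subspace `W`, is inner, given by an element of `W`. -/
theorem exists_eq_coboundary {k G A : Type*} [Field k] [Group G] [AddCommGroup A] [Module k A]
    [FiniteDimensional k A] (ρ : Representation k G A) {S : Set G} {n : ℕ}
    (hn : ∀ g, g ∈ relUpperCentral Set.univ S n) (hS : ∀ s ∈ S, ∀ a, ρ s a = a)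
    (hfix : ∀ a, (∀ g, ρ g a = a) → a = 0) (W : Submodule k A) (hW : ∀ g, ∀ w ∈ W, ρ g w ∈ W)
    (d : G → A) (hdW : ∀ g, d g ∈ W) (hd : ∀ g h, d (g * h) = d g + ρ g (d h))
    (hdS : ∀ s ∈ S, d s = 0) :
    ∃ w ∈ W, ∀ g, d g = ρ g w - w := by
  induction hm : Module.finrank k W using Nat.strong_induction_on generalizing W d with
  | _ m ih =>
  subst hm
  by_cases htriv : ∀ g, ∀ w ∈ W, ρ g w = w
  · refine ⟨0, W.zero_mem, fun g => ?_⟩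
    simpa using hfix _ fun h => htriv h _ (hdW g)
  -- `i + 1` is the first index for which the central series acts nontrivially on `W`.
  have hex : ∃ i, ¬ ∀ g ∈ relUpperCentral Set.univ S i, ∀ w ∈ W, ρ g w = w :=
    ⟨n, fun h => htriv fun g => h g (hn g)⟩
  classical
  obtain ⟨i, hi⟩ : ∃ i, Nat.find hex = i + 1 := by
    refine Nat.exists_eq_succ_of_ne_zero fun h0 => ?_
    have := Nat.find_spec hex
    rw [h0] at this
    exact this fun g hg w _ => hS g hg w
  have hlow : ∀ j ≤ i, ∀ g ∈ relUpperCentral Set.univ S j, ∀ w ∈ W, ρ g w = w := fun j hj =>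
    not_not.1 (Nat.find_min hex (by omega))
  have hup := Nat.find_spec hex
  rw [hi] at hup
  push Not at hup
  obtain ⟨z, hz, w₁, hw₁, hzw₁⟩ := hup
  have hcomm : ∀ x g : G, x * g = ⁅x, g⁆ * (g * x) := fun x g => by
    rw [commutatorElement_def]; group
  have hd0 : ∀ j ≤ i, ∀ g ∈ relUpperCentral Set.univ S j, d g = 0 := by
    intro j
    induction j with
    | zero => exact fun _ => hdS
    | succ j ihj =>
      intro hj x hx
      refine hfix _ fun g => ?_
      have hc := hx g trivial
      have h1 : d (x * g) = d (g * x) := by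
        rw [hcomm x g, hd, ihj (by omega) _ hc, hlow j (by omega) _ hc _ (hdW _), zero_add]
      rw [hd, hd, hlow _ hj x hx _ (hdW _), add_comm] at h1
      exact (add_left_cancel h1).symm
  set f : A →ₗ[k] A := ρ z - 1 with hf
  have hfa : ∀ a, f a = ρ z a - a := fun a => by simp [hf]
  have hρcomm : ∀ g, ∀ w ∈ W, ρ z (ρ g w) = ρ g (ρ z w) := by
    intro g w hw
    have hc := hz g trivial
    rw [← Module.End.mul_apply, ← map_mul, hcomm z g, map_mul, map_mul, Module.End.mul_apply,
      Module.End.mul_apply, hlow i le_rfl _ hc _ (hW _ _ (hW _ _ hw))]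
  have hfcomm : ∀ g, ∀ w ∈ W, f (ρ g w) = ρ g (f w) := by
    intro g w hw
    rw [hfa, hfa, map_sub, hρcomm g w hw]
  have hfd : ∀ g, f (d g) = ρ g (d z) - d z := by
    intro g
    have hc := hz g trivial
    have h1 : d (z * g) = d (g * z) := by
      rw [hcomm z g, hd, hd0 i le_rfl _ hc, hlow i le_rfl _ hc _ (hdW _), zero_add]
    rw [hd, hd] at h1
    rw [hfa, sub_eq_sub_iff_add_eq_add, add_comm, h1, add_comm]
  have hfW : ∀ w ∈ W, f w ∈ W := fun w hw => by
    rw [hfa]; exact W.sub_mem (hW _ _ hw) hw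
  set R : Submodule k A := W.map f with hR
  set U : Submodule k A := W ⊓ LinearMap.ker f with hU
  have hRW : R ≤ W := by
    rintro _ ⟨w, hw, rfl⟩; exact hfW w hw
  have hdim : Module.finrank k R + Module.finrank k U = Module.finrank k W := by
    have h := LinearMap.finrank_range_add_finrank_ker (f.domRestrict W)
    have h1 : LinearMap.range (f.domRestrict W) = R := by
      rw [hR, LinearMap.range_domRestrict]
    have h2 : Module.finrank k (LinearMap.ker (f.domRestrict W)) = Module.finrank k U := by
      rw [LinearMap.ker_domRestrict, hU, ← Submodule.map_comap_subtype]
      exact (Submodule.finrank_map_subtype_eq W _).symm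
    rw [h1, h2] at h
    exact h
  have hRpos : 0 < Module.finrank k R := by
    refine Module.finrank_pos_iff_exists_ne_zero.2 ⟨⟨f w₁, w₁, hw₁, rfl⟩, fun h => hzw₁ ?_⟩
    have := congrArg Subtype.val h
    simpa [hfa, sub_eq_zero] using this
  have hUinv : ∀ g, ∀ w ∈ U, ρ g w ∈ U := fun g w hw =>
    ⟨hW g w hw.1, by
      change f _ = 0
      rw [hfcomm g w hw.1, LinearMap.mem_ker.1 hw.2, map_zero]⟩
  -- `f ∘ d` is inner: it takes values in `R`, and if `f` is invertible on `W`, then `hfd` says so.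
  obtain ⟨r, hr, hfr⟩ : ∃ r ∈ W, ∀ g, f (d g) = f (ρ g r - r) := by
    rcases Nat.eq_zero_or_pos (Module.finrank k U) with hU0 | hUpos
    · have hRW' : R = W := Submodule.eq_of_le_of_finrank_eq hRW (by omega)
      obtain ⟨r, hr, hrz⟩ : d z ∈ R := hRW' ▸ hdW z
      refine ⟨r, hr, fun g => ?_⟩
      rw [hfd, map_sub, hfcomm g r hr, hrz]
    · obtain ⟨_, ⟨r, hr, rfl⟩, h⟩ := ih _ (by omega) R
        (by
          rintro g _ ⟨w, hw, rfl⟩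
          exact ⟨ρ g w, hW g w hw, hfcomm g w hw⟩)
        (fun g => f (d g)) (fun g => ⟨d g, hdW g, rfl⟩)
        (fun g h => by rw [hd, map_add, hfcomm g _ (hdW h)])
        (fun s hs => by rw [hdS s hs, map_zero]) rfl
      exact ⟨r, hr, fun g => by rw [h, map_sub, hfcomm g r hr]⟩
  -- What remains of `d` takes values in the kernel of `f`.
  obtain ⟨u, hu, hdu⟩ := ih _ (by omega) U hUinv (fun g => d g - (ρ g r - r))
    (fun g => ⟨W.sub_mem (hdW g) (W.sub_mem (hW g r hr) hr), by
      change f _ = 0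
      rw [map_sub, hfr, sub_self]⟩)
    (fun g h => by
      rw [hd, map_mul, Module.End.mul_apply, map_sub, map_sub]; abel)
    (fun s hs => by rw [hdS s hs, hS s hs, sub_self, sub_self]) rfl
  refine ⟨u + r, W.add_mem hu.1 hr, fun g => ?_⟩
  rw [map_add, ← sub_add_cancel (d g) (ρ g r - r), hdu]
  abel

/-- Under the hypotheses of `exists_eq_coboundary`, quotients of the module also have no nonzero
fixed vectors. -/
theorem mem_of_forall_sub_mem {k G A : Type*} [Field k] [Group G] [AddCommGroup A] [Module k A]
    [FiniteDimensional k A] (ρ : Representation k G A) {S : Set G} {n : ℕ}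
    (hn : ∀ g, g ∈ relUpperCentral Set.univ S n) (hS : ∀ s ∈ S, ∀ a, ρ s a = a)
    (hfix : ∀ a, (∀ g, ρ g a = a) → a = 0) (W : Submodule k A) (hW : ∀ g, ∀ w ∈ W, ρ g w ∈ W)
    (a : A) (ha : ∀ g, ρ g a - a ∈ W) : a ∈ W := by
  obtain ⟨w, hw, h⟩ := exists_eq_coboundary ρ hn hS hfix W hW (fun g => ρ g a - a) ha
    (fun g h => by rw [map_mul, Module.End.mul_apply, map_sub]; abel)
    (fun s hs => by rw [hS s hs, sub_self])
  have : a - w = 0 := hfix _ fun g => by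
    have := h g
    rw [map_sub, sub_eq_sub_iff_sub_eq_sub, this]
  rwa [sub_eq_zero.1 this]

/-- A derivation whose values on the trivially acting set lie in `W` is inner modulo `W`. -/
theorem exists_sub_coboundary_mem {k G A : Type*} [Field k] [Group G] [AddCommGroup A] [Module k A]
    [FiniteDimensional k A] (ρ : Representation k G A) {S : Set G} {n : ℕ}
    (hn : ∀ g, g ∈ relUpperCentral Set.univ S n) (hS : ∀ s ∈ S, ∀ a, ρ s a = a)
    (hfix : ∀ a, (∀ g, ρ g a = a) → a = 0) (W : Submodule k A) (hW : ∀ g, ∀ w ∈ W, ρ g w ∈ W)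
    (d : G → A) (hd : ∀ g h, d (g * h) = d g + ρ g (d h)) (hdS : ∀ s ∈ S, d s ∈ W) :
    ∃ a, ∀ g, d g - (ρ g a - a) ∈ W := by
  let ρ' : Representation k G (A ⧸ W) :=
    { toFun := fun g => W.mapQ W (ρ g) (hW g)
      map_one' := by ext; simp
      map_mul' := fun g h => by ext; simp }
  have hρ' : ∀ g a, ρ' g (W.mkQ a) = W.mkQ (ρ g a) := fun g a => rfl
  obtain ⟨a', -, h⟩ := exists_eq_coboundary ρ' hn
    (fun s hs a => by
      obtain ⟨a, rfl⟩ := W.mkQ_surjective a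
      rw [hρ', hS s hs])
    (fun a ha => by
      obtain ⟨a, rfl⟩ := W.mkQ_surjective a
      rw [Submodule.mkQ_apply, Submodule.Quotient.mk_eq_zero]
      refine mem_of_forall_sub_mem ρ hn hS hfix W hW a fun g => ?_
      rw [← Submodule.Quotient.mk_eq_zero, Submodule.Quotient.mk_sub, sub_eq_zero]
      exact ha g)
    ⊤ (fun _ _ _ => trivial) (fun g => W.mkQ (d g)) (fun _ => trivial)
    (fun g h => by rw [hρ', ← map_add, hd])
    (fun s hs => by
      rw [Submodule.mkQ_apply, Submodule.Quotient.mk_eq_zero]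
      exact hdS s hs)
  obtain ⟨a, rfl⟩ := W.mkQ_surjective a'
  refine ⟨a, fun g => ?_⟩
  rw [← Submodule.Quotient.mk_eq_zero, Submodule.Quotient.mk_sub, Submodule.Quotient.mk_sub,
    sub_eq_zero]
  exact h g

/-! ### Splitting over rational normal subgroups -/

theorem mem_relUpperCentral_of_map {G H : Type*} [Group G] [Group H] (φ : G →* H)
    {P S : Set G} {P' S' : Set H} (hP : ∀ p ∈ P, φ p ∈ P') (hS : ∀ s, φ s ∈ S' → s ∈ S) :
    ∀ (n : ℕ) (x : G), φ x ∈ relUpperCentral P' S' n → x ∈ relUpperCentral P S n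
  | 0, x, hx => hS x hx
  | n + 1, x, hx => fun p hp => mem_relUpperCentral_of_map φ hP hS n _ <| by
      rw [map_commutatorElement]
      exact hx _ (hP p hp)

/-- `ι` identifies the additive group `A` with an abelian normal subgroup of the multiplicative
group `E`. -/
structure IsNormalEmbedding {E A : Type*} [Group E] [AddCommGroup A] (ι : A → E) : Prop where
  map_add : ∀ a b, ι (a + b) = ι a * ι b
  injective : Function.Injective ι
  conj : ∀ g a, ∃ b, ι b = g * ι a * g⁻¹

namespace IsNormalEmbedding

variable {E A : Type*} [Group E] [AddCommGroup A] {ι : A → E} (hι : IsNormalEmbedding ι)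
include hι

theorem map_zero : ι 0 = 1 := by
  simpa using hι.map_add 0 0

theorem map_neg (a : A) : ι (-a) = (ι a)⁻¹ := by
  rw [eq_inv_iff_mul_eq_one, ← hι.map_add, neg_add_cancel, hι.map_zero]

theorem map_sub (a b : A) : ι (a - b) = ι a * (ι b)⁻¹ := by
  rw [sub_eq_add_neg, hι.map_add, hι.map_neg]

theorem eq_zero {a : A} (h : ι a = 1) : a = 0 := hι.injective (h.trans hι.map_zero.symm)

/-- The conjugation action on a rational normal subgroup is automatically linear. -/
theorem exists_representation [Module ℚ A] :
    ∃ ρ : Representation ℚ E A, ∀ g a, ι (ρ g a) = g * ι a * g⁻¹ := by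
  choose c hc using hι.conj
  refine ⟨{ toFun := fun g => (AddMonoidHom.mk' (c g) fun a b => hι.injective ?_).toRatLinearMap
            map_one' := ?_
            map_mul' := fun g h => ?_ }, fun g a => hc g a⟩
  · rw [hc, hι.map_add, hι.map_add, hc, hc]; group
  · ext a
    exact hι.injective (by simp [hc])
  · ext a
    refine hι.injective ?_
    change ι (c (g * h) a) = ι (c g (c h a))
    rw [hc, hc, hc]; group

variable [Module ℚ A] {ρ : Representation ℚ E A} (hρ : ∀ g a, ι (ρ g a) = g * ι a * g⁻¹)
include hρ

theorem apply_self (a b : A) : ρ (ι a) b = b := by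
  refine hι.injective ?_
  rw [hρ, ← hι.map_add, ← hι.map_neg, ← hι.map_add]
  congr 1
  abel

theorem commutator_eq (a : A) (g : E) : ⁅ι a, g⁆ = ι (a - ρ g a) := by
  rw [hι.map_sub, hρ, commutatorElement_def]; group

/-- If commutation with `v` has values in `ι A` modulo the kernel of `π`, it is given there by a
derivation. -/
theorem exists_derivation {F : Type*} [Group F] (π : E →* F)
    (hπ : ∀ a, π (ι a) = 1 → a = 0) (v : E) (hv : ∀ x : E, ∃ a, π (ι a) = π ⁅x, v⁆) :
    ∃ d : E → A, (∀ x, π (ι (d x)) = π ⁅x, v⁆) ∧ ∀ x y, d (x * y) = d x + ρ x (d y) := by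
  choose d hd using hv
  refine ⟨d, hd, fun x y => ?_⟩
  rw [← sub_eq_zero]
  refine hπ _ ?_
  rw [add_comm, hι.map_sub, hι.map_add, hρ]
  simp only [_root_.map_mul, _root_.map_inv, hd, commutatorElement_def]
  group

theorem eq_zero_of_mem_upperCentralSeries (hfix : ∀ a, (∀ g, ρ g a = a) → a = 0) (j : ℕ) :
    ∀ a : A, ι a ∈ Subgroup.upperCentralSeries E j → a = 0 := by
  induction j with
  | zero => exact fun a ha => hι.eq_zero (by simpa using ha)
  | succ j ih =>
    refine fun a ha => hfix a fun g => ?_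
    have h := Subgroup.mem_upperCentralSeries_succ_iff.1 ha g
    rw [hι.commutator_eq hρ] at h
    exact (sub_eq_zero.1 (ih _ h)).symm

variable [FiniteDimensional ℚ A]

/-- As long as the central series of `E` modulo `ι A` acts trivially on `A`, it lifts to the upper
central series of `E`: the obstruction is a derivation. -/
theorem exists_mul_mem_upperCentralSeries (hfix : ∀ a, (∀ g, ρ g a = a) → a = 0) {n : ℕ}
    (hn : ∀ g, g ∈ relUpperCentral Set.univ (Set.range ι) n) {i : ℕ}
    (htriv : ∀ j ≤ i, ∀ g ∈ relUpperCentral Set.univ (Set.range ι) j, ∀ a, ρ g a = a) :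
    ∀ j ≤ i, ∀ u ∈ relUpperCentral Set.univ (Set.range ι) j,
      ∃ a, ι a * u ∈ Subgroup.upperCentralSeries E j := by
  intro j
  induction j with
  | zero =>
    rintro - _ ⟨a, rfl⟩
    exact ⟨-a, by rw [← hι.map_add, neg_add_cancel, hι.map_zero]; exact one_mem _⟩
  | succ j ih =>
    intro hj u hu
    let π := QuotientGroup.mk' (Subgroup.upperCentralSeries E j)
    have hπ : ∀ g, π g = 1 ↔ g ∈ Subgroup.upperCentralSeries E j := fun g =>
      QuotientGroup.eq_one_iff g
    have hπι : ∀ a, π (ι a) = 1 → a = 0 := fun a ha =>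
      hι.eq_zero_of_mem_upperCentralSeries hρ hfix j a ((hπ _).1 ha)
    obtain ⟨d, hdπ, hd⟩ := hι.exists_derivation hρ π hπι u fun x => by
      obtain ⟨a, ha⟩ := ih (by omega) _ (hu x trivial)
      refine ⟨a, ?_⟩
      rw [← hπ, _root_.map_mul] at ha
      rw [eq_inv_of_mul_eq_one_left ha, ← _root_.map_inv, commutatorElement_inv]
    obtain ⟨w, -, hw⟩ := exists_eq_coboundary ρ hn
      (by rintro _ ⟨a, rfl⟩ b; exact hι.apply_self hρ a b) hfix ⊤ (fun _ _ _ => trivial) d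
      (fun _ => trivial) hd (by
        rintro _ ⟨a, rfl⟩
        refine hπι _ ?_
        rw [hdπ, hι.commutator_eq hρ, htriv _ hj u hu, sub_self, hι.map_zero, _root_.map_one])
    refine ⟨-w, Subgroup.mem_upperCentralSeries_succ_iff.2 fun x => (hπ _).1 ?_⟩
    have h := hdπ x
    rw [hw, hι.map_sub, hρ] at h
    simp only [hι.map_neg, commutatorElement_def, _root_.map_mul, _root_.map_inv] at h ⊢
    generalize π x = x at *
    generalize π (ι w) = a at *
    generalize π u = u at *
    have h1 : a * x⁻¹ * a⁻¹ = u * x⁻¹ * u⁻¹ := by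
      have := congrArg (x⁻¹ * ·) h
      simpa [mul_assoc] using this
    have h2 : u * x⁻¹ = a * x⁻¹ * a⁻¹ * u := by rw [h1]; group
    calc a⁻¹ * u * x * (a⁻¹ * u)⁻¹ * x⁻¹ = a⁻¹ * u * x * u⁻¹ * (a * x⁻¹ * a⁻¹) * a := by group
      _ = 1 := by rw [h1]; group

/-- If `A` has no nonzero fixed vectors but is nonzero, there is a proper partial complement: a
supplement meeting `A` in a proper subspace. -/
theorem exists_supplement (hfix : ∀ a, (∀ g, ρ g a = a) → a = 0) {n : ℕ}
    (hn : ∀ g, g ∈ relUpperCentral Set.univ (Set.range ι) n) (hA : ∃ a : A, a ≠ 0) :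
    ∃ (C : Subgroup E) (U : Submodule ℚ A), U ≠ ⊤ ∧ (∀ a, ι a ∈ C ↔ a ∈ U) ∧
      ∀ x, ∃ a, ι a * x ∈ C := by
  have hself : ∀ s ∈ Set.range ι, ∀ a, ρ s a = a := by
    rintro _ ⟨a, rfl⟩ b; exact hι.apply_self hρ a b
  have hex : ∃ i, ¬ ∀ g ∈ relUpperCentral Set.univ (Set.range ι) i, ∀ a, ρ g a = a := by
    obtain ⟨a, ha⟩ := hA
    exact ⟨n, fun h => ha <| hfix a fun g => h g (hn g) a⟩
  classical
  obtain ⟨i, hi⟩ : ∃ i, Nat.find hex = i + 1 := by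
    refine Nat.exists_eq_succ_of_ne_zero fun h0 => ?_
    have := Nat.find_spec hex
    rw [h0] at this
    exact this hself
  have hlow : ∀ j ≤ i, ∀ g ∈ relUpperCentral Set.univ (Set.range ι) j, ∀ a, ρ g a = a :=
    fun j hj => not_not.1 (Nat.find_min hex (by omega))
  have hup := Nat.find_spec hex
  rw [hi] at hup
  push Not at hup
  obtain ⟨z, hz, a₁, hza₁⟩ := hup
  let π := QuotientGroup.mk' (Subgroup.upperCentralSeries E i)
  have hπ : ∀ g, π g = 1 ↔ g ∈ Subgroup.upperCentralSeries E i := fun g =>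
    QuotientGroup.eq_one_iff g
  have hπι : ∀ a, π (ι a) = 1 → a = 0 := fun a ha =>
    hι.eq_zero_of_mem_upperCentralSeries hρ hfix i a ((hπ _).1 ha)
  obtain ⟨d, hdπ, hd⟩ := hι.exists_derivation hρ π hπι z fun x => by
    obtain ⟨a, ha⟩ := hι.exists_mul_mem_upperCentralSeries hρ hfix hn hlow i le_rfl _ (hz x trivial)
    refine ⟨a, ?_⟩
    rw [← hπ, _root_.map_mul] at ha
    rw [eq_inv_of_mul_eq_one_left ha, ← _root_.map_inv, commutatorElement_inv]
  set f : A →ₗ[ℚ] A := 1 - ρ z with hf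
  have hfa : ∀ a, f a = a - ρ z a := fun a => by simp [hf]
  have hdι : ∀ b, d (ι b) = f b := fun b => by
    rw [← sub_eq_zero]
    refine hπι _ ?_
    rw [hι.map_sub, _root_.map_mul, _root_.map_inv, hdπ, hι.commutator_eq hρ, hfa, mul_inv_cancel]
  have hfcomm : ∀ g a, f (ρ g a) = ρ g (f a) := fun g a => by
    have hc := hlow i le_rfl _ (hz g trivial) (ρ (g * z) a)
    rw [← Module.End.mul_apply, ← _root_.map_mul, commutatorElement_def] at hc
    rw [hfa, hfa, _root_.map_sub, ← Module.End.mul_apply, ← Module.End.mul_apply, ← _root_.map_mul,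
      ← _root_.map_mul, ← hc]
    congr 3
    group
  obtain ⟨a₀, ha₀⟩ := exists_sub_coboundary_mem ρ hn hself hfix (LinearMap.range f)
    (by rintro g _ ⟨a, rfl⟩; exact ⟨ρ g a, hfcomm g a⟩) d hd
    (by rintro _ ⟨b, rfl⟩; exact ⟨b, (hdι b).symm⟩)
  -- The supplement is the kernel of a derivation with values in the range of `f`, whose restriction
  -- to `A` is `f`.
  set e : E → A := fun g => d g - (ρ g a₀ - a₀) with he
  have he_mul : ∀ g h, e (g * h) = e g + ρ g (e h) := fun g h => by
    simp only [he]
    rw [hd, _root_.map_mul, Module.End.mul_apply, _root_.map_sub, _root_.map_sub]; abel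
  have heι : ∀ b, e (ι b) = f b := fun b => by
    simp only [he]
    rw [hdι, hι.apply_self hρ, sub_self, sub_zero]
  have he_one : e 1 = 0 := by simpa using he_mul 1 1
  refine ⟨{ carrier := {x | e x = 0}
            one_mem' := he_one
            mul_mem' := fun {x y} hx hy => by
              change e (x * y) = 0
              rw [he_mul, hx, hy, _root_.map_zero, add_zero]
            inv_mem' := fun {x} hx => by
              have h := he_mul x⁻¹ x
              rw [inv_mul_cancel, he_one, hx, _root_.map_zero, add_zero] at h
              exact h.symm }, LinearMap.ker f, ?_, ?_, ?_⟩
  · intro h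
    have : f a₁ = 0 := LinearMap.mem_ker.1 (h ▸ Submodule.mem_top)
    rw [hfa, sub_eq_zero] at this
    exact hza₁ this.symm
  · intro a
    change e (ι a) = 0 ↔ f a = 0
    rw [heι]
  · intro x
    obtain ⟨b, hb⟩ := ha₀ x
    refine ⟨-b, ?_⟩
    change e _ = 0
    rw [he_mul, heι, hι.apply_self hρ, _root_.map_neg, hb, neg_add_cancel]

end IsNormalEmbedding


/-- A group `E` that is nilpotent modulo a finite-dimensional rational normal subgroup `A` splits
over `A` if no nontrivial element of `A` is central in `E`. -/
theorem exists_complement (m : ℕ) : ∀ {E : Type u} {A : Type v} [Group E] [AddCommGroup A]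
    [Module ℚ A] [FiniteDimensional ℚ A] {ι : A → E} (_ : IsNormalEmbedding ι)
    (_ : ∀ a, (∀ g : E, g * ι a = ι a * g) → a = 0) {n : ℕ}
    (_ : ∀ g, g ∈ relUpperCentral Set.univ (Set.range ι) n) (_ : Module.finrank ℚ A = m),
    ∃ C : Subgroup E, (∀ a, ι a ∈ C → a = 0) ∧ ∀ x, ∃ a, ι a * x ∈ C := by
  induction m using Nat.strong_induction_on with
  | _ m ih =>
  intro E A _ _ _ _ ι hι hfix n hn hm
  by_cases hA : ∃ a : A, a ≠ 0
  swap
  · push Not at hA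
    exact ⟨⊤, fun a _ => hA a, fun _ => ⟨0, trivial⟩⟩
  obtain ⟨ρ, hρ⟩ := hι.exists_representation
  obtain ⟨C, U, hU, hCU, hC⟩ := hι.exists_supplement hρ
    (fun a ha => hfix a fun g => by
      rw [← mul_inv_eq_iff_eq_mul, ← hρ, ha]) hn hA
  let ι' : U → C := fun a => ⟨ι a, (hCU a).2 a.2⟩
  have hι' : IsNormalEmbedding ι' :=
    { map_add := fun a b => Subtype.ext (hι.map_add a b)
      injective := fun a b h => Subtype.ext (hι.injective (congrArg Subtype.val h))
      conj := fun g a => by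
        obtain ⟨b, hb⟩ := hι.conj g a
        have : b ∈ U := (hCU b).1 (hb ▸ C.mul_mem (C.mul_mem g.2 (ι' a).2) (C.inv_mem g.2))
        exact ⟨⟨b, this⟩, Subtype.ext hb⟩ }
  obtain ⟨D, hD, hD'⟩ := ih _ (hm ▸ Submodule.finrank_lt hU) hι'
    (fun a ha => Subtype.ext <| hfix a fun g => by
      -- `g` acts on `A` as the element `ι b * g` of `C` does
      obtain ⟨b, hb⟩ := hC g
      have h1 : ι b * g * ι a = ι a * (ι b * g) := congrArg Subtype.val (ha ⟨_, hb⟩)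
      have h2 : ι a * ι b = ι b * ι a := by rw [← hι.map_add, ← hι.map_add, add_comm]
      rw [← mul_assoc, h2, mul_assoc, mul_assoc] at h1
      exact mul_left_cancel h1)
    (n := n) (fun g => mem_relUpperCentral_of_map C.subtype (fun _ _ => Set.mem_univ _) (by
      rintro ⟨_, hs⟩ ⟨a, rfl⟩
      exact ⟨⟨a, (hCU a).1 hs⟩, rfl⟩) n g (hn g)) rfl
  refine ⟨D.map C.subtype, ?_, fun x => ?_⟩
  · rintro a ⟨c, hc, hca⟩
    have haU : a ∈ U := (hCU a).1 (hca ▸ c.2)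
    have : (⟨a, haU⟩ : U) = 0 := hD _ (by
      have : ι' ⟨a, haU⟩ = c := Subtype.ext hca.symm
      rwa [this])
    exact congrArg Subtype.val this
  · obtain ⟨a, ha⟩ := hC x
    obtain ⟨b, hb⟩ := hD' ⟨_, ha⟩
    exact ⟨b + a, _, hb, by simp [ι', hι.map_add, mul_assoc]⟩

/-! ### Conjugacy of complements and the Frattini argument -/

theorem map_mem_relUpperCentral {G H : Type*} [Group G] [Group H] (φ : G →* H)
    {P S : Set G} {P' S' : Set H} (hP : P' ⊆ φ '' P) (hS : ∀ s ∈ S, φ s ∈ S') :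
    ∀ (n : ℕ) (x : G), x ∈ relUpperCentral P S n → φ x ∈ relUpperCentral P' S' n
  | 0, x, hx => hS x hx
  | n + 1, x, hx => fun p hp => by
      obtain ⟨q, hq, rfl⟩ := hP hp
      rw [← map_commutatorElement]
      exact map_mem_relUpperCentral φ hP hS n _ (hx q hq)

theorem relUpperCentral_subset_add {G : Type*} [Group G] {P S S' : Set G} {m : ℕ}
    (h : S ⊆ relUpperCentral P S' m) (n : ℕ) :
    relUpperCentral P S n ⊆ relUpperCentral P S' (m + n) := by
  induction n with
  | zero => exact h
  | succ n ih => exact fun x hx p hp => ih (hx p hp)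

theorem mem_upperCentralSeries_iff_relUpperCentral {G : Type*} [Group G] (n : ℕ) :
    ∀ x : G, x ∈ Subgroup.upperCentralSeries G n ↔ x ∈ relUpperCentral Set.univ {1} n := by
  induction n with
  | zero => exact fun x => by simp [relUpperCentral]
  | succ n ih =>
    intro x
    rw [Subgroup.mem_upperCentralSeries_succ_iff]
    exact ⟨fun h g _ => (ih _).1 (h g), fun h g => (ih _).2 (h g trivial)⟩

theorem isNilpotent_iff_relUpperCentral {G : Type*} [Group G] :
    Group.IsNilpotent G ↔ ∃ n, ∀ g : G, g ∈ relUpperCentral Set.univ {1} n := by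
  refine ⟨fun h => ?_, fun ⟨n, hn⟩ => ⟨n, ?_⟩⟩
  · obtain ⟨n, hn⟩ := h.nilpotent'
    exact ⟨n, fun g => (mem_upperCentralSeries_iff_relUpperCentral n g).1 (hn ▸ trivial)⟩
  · exact eq_top_iff.2 fun g _ => (mem_upperCentralSeries_iff_relUpperCentral n g).2 (hn g)

/-- Given a complement `C` of `A`, each nilpotent subgroup of `A ⋊ C` that centralizes no nonzero
element of `A` is conjugate into `C` by an element of `A`. -/
theorem IsNormalEmbedding.exists_conj_mem {Q A : Type*} [Group Q] [AddCommGroup A] [Module ℚ A]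
    [FiniteDimensional ℚ A] {ι : A → Q} (hι : IsNormalEmbedding ι) {C L : Subgroup Q}
    (hC : ∀ a, ι a ∈ C → a = 0) (hLC : ∀ l ∈ L, ∃ a, ι a * l ∈ C) (hL : Group.IsNilpotent L)
    (hfix : ∀ a, (∀ l ∈ L, l * ι a = ι a * l) → a = 0) :
    ∃ w, ∀ l ∈ L, (ι w)⁻¹ * l * ι w ∈ C := by
  obtain ⟨ρ, hρ⟩ := hι.exists_representation
  obtain ⟨n, hn⟩ := isNilpotent_iff_relUpperCentral.1 hL
  have huniq : ∀ (x : Q) (a b : A), ι a * x ∈ C → ι b * x ∈ C → a = b := fun x a b ha hb => by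
    refine sub_eq_zero.1 (hC _ ?_)
    have := C.mul_mem ha (C.inv_mem hb)
    rw [hι.map_sub]
    convert this using 1
    group
  -- `d l` is the unique `a` with `ι a * l ∈ C`; uniqueness makes it a derivation
  choose! d hd using hLC
  obtain ⟨w, -, hw⟩ := exists_eq_coboundary (ρ.comp L.subtype) hn
    (by rintro _ rfl a; simp)
    (fun a ha => hfix a fun l hl => by
      rw [← mul_inv_eq_iff_eq_mul, ← hρ]
      exact congrArg ι (ha ⟨l, hl⟩))
    ⊤ (fun _ _ _ => trivial) (fun l => d l) (fun _ => trivial)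
    (fun g h => huniq (g * h) _ _ (hd _ (g * h).2) (by
      have := C.mul_mem (hd _ g.2) (hd _ h.2)
      change ι (d g + ρ g (d h)) * _ ∈ C
      rw [hι.map_add, hρ]
      convert this using 1
      group))
    (by
      rintro _ rfl
      exact huniq 1 _ _ (hd _ L.one_mem) (by rw [hι.map_zero, one_mul]; exact C.one_mem))
  refine ⟨w, fun l hl => ?_⟩
  have h := hd l hl
  have h1 : d l = -w + ρ l w := by
    rw [neg_add_eq_sub]; exact hw ⟨l, hl⟩
  rw [h1, hι.map_add, hι.map_neg, hρ] at h
  convert h using 1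
  group

/-- Frattini argument: if the normal subgroup `P` is nilpotent modulo `A` and centralizes no nonzero
element of `A`, then the normalizer of a complement of `A` in `P` is a complement of `A` in `Q`.
The second alternative for `L` ensures that some complement of `A` in `P` contains `L`. -/
theorem IsNormalEmbedding.exists_complement_of_normal {Q A : Type*} [Group Q] [AddCommGroup A]
    [Module ℚ A] [FiniteDimensional ℚ A] {ι : A → Q} (hι : IsNormalEmbedding ι) {P L : Subgroup Q}
    [P.Normal] (hιP : ∀ a, ι a ∈ P) {n : ℕ}
    (hn : ∀ p ∈ P, p ∈ relUpperCentral (P : Set Q) (Set.range ι) n)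
    (hfix : ∀ a, (∀ p ∈ P, p * ι a = ι a * p) → a = 0) (hLP : L ≤ P) (hL : Group.IsNilpotent L)
    (hLfix : L = ⊥ ∨ ∀ a, (∀ l ∈ L, l * ι a = ι a * l) → a = 0) :
    ∃ Q₀ : Subgroup Q, L ≤ Q₀ ∧ (∀ x, ∃ a, ι a * x ∈ Q₀) ∧ ∀ a, ι a ∈ Q₀ → a = 0 := by
  obtain ⟨C, hCP, hC, hPC, hLC⟩ : ∃ C : Subgroup Q, C ≤ P ∧ (∀ a, ι a ∈ C → a = 0) ∧
      (∀ p ∈ P, ∃ a, ι a * p ∈ C) ∧ L ≤ C := by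
    let ι' : A → P := fun a => ⟨ι a, hιP a⟩
    have hι' : IsNormalEmbedding ι' :=
      { map_add := fun a b => Subtype.ext (hι.map_add a b)
        injective := fun a b h => hι.injective (congrArg Subtype.val h)
        conj := fun g a => by
          obtain ⟨b, hb⟩ := hι.conj g a
          exact ⟨b, Subtype.ext hb⟩ }
    obtain ⟨D, hD, hD'⟩ := exists_complement _ hι'
      (fun a ha => hfix a fun p hp => congrArg Subtype.val (ha ⟨p, hp⟩)) (n := n)
      (fun g => mem_relUpperCentral_of_map P.subtype (fun p _ => p.2)
        (by rintro s ⟨a, ha⟩; exact ⟨a, Subtype.ext ha⟩) n g (hn g g.2)) rfl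
    have hC₁ : ∀ a, ι a ∈ D.map P.subtype → a = 0 := by
      rintro a ⟨c, hc, hca⟩
      refine hD a ?_
      have : ι' a = c := Subtype.ext hca.symm
      rwa [this]
    have hC₂ : ∀ p ∈ P, ∃ a, ι a * p ∈ D.map P.subtype := fun p hp => by
      obtain ⟨a, ha⟩ := hD' ⟨p, hp⟩
      exact ⟨a, _, ha, rfl⟩
    have hC₃ : D.map P.subtype ≤ P := Subgroup.map_subtype_le D
    generalize D.map P.subtype = C at *
    rcases hLfix with rfl | hLfix
    · exact ⟨C, hC₃, hC₁, hC₂, bot_le⟩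
    obtain ⟨w, hw⟩ := hι.exists_conj_mem hC₁ (fun l hl => hC₂ l (hLP hl)) hL hLfix
    -- conjugation by `ι w` moves `C` to a complement containing `L`
    have hmem : ∀ x, x ∈ C.map (MulAut.conj (ι w)).toMonoidHom ↔ (ι w)⁻¹ * x * ι w ∈ C := by
      intro x
      constructor
      · rintro ⟨c, hc, rfl⟩
        convert hc using 1
        simp [mul_assoc]
      · exact fun h => ⟨_, h, by simp [mul_assoc]⟩
    have hcomm : ∀ a, (ι w)⁻¹ * ι a * ι w = ι a := fun a => by
      rw [← hι.map_neg, ← hι.map_add, ← hι.map_add]; congr 1; abel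
    refine ⟨_, ?_, fun a ha => ?_, fun p hp => ?_, fun l hl => (hmem l).2 (hw l hl)⟩
    · rintro _ ⟨c, hc, rfl⟩
      exact Subgroup.Normal.conj_mem inferInstance _ (hC₃ hc) _
    · rw [hmem, hcomm] at ha
      exact hC₁ a ha
    · obtain ⟨a, ha⟩ := hC₂ ((ι w)⁻¹ * p * ι w)
        (P.mul_mem (P.mul_mem (P.inv_mem (hιP w)) hp) (hιP w))
      refine ⟨a, (hmem _).2 ?_⟩
      convert ha using 1
      conv_rhs => rw [← hcomm a]
      group
  have hfixC : ∀ a, (∀ c ∈ C, c * ι a = ι a * c) → a = 0 := fun a ha => hfix a fun p hp => by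
    obtain ⟨b, hb⟩ := hPC p hp
    have h1 := ha _ hb
    have h2 : ι a * ι b = ι b * ι a := by rw [← hι.map_add, ← hι.map_add, add_comm]
    rw [← mul_assoc, h2, mul_assoc, mul_assoc] at h1
    exact mul_left_cancel h1
  have hCnil : Group.IsNilpotent C := isNilpotent_iff_relUpperCentral.2
    ⟨n, fun c => mem_relUpperCentral_of_map C.subtype (fun p _ => hCP p.2) (by
      rintro s ⟨a, ha⟩
      have h0 := hC a (ha ▸ s.2)
      rw [h0, hι.map_zero] at ha
      exact Subtype.ext ha.symm) n c (hn c (hCP c.2))⟩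
  refine ⟨Subgroup.normalizer C, hLC.trans Subgroup.le_normalizer, fun x => ?_,
    fun a ha => hfixC a fun c hc => ?_⟩
  · -- the complement `x C x⁻¹` is conjugate to `C` by an element of `A`
    have hmem : ∀ y, y ∈ C.map (MulAut.conj x).toMonoidHom → ∃ c ∈ C, y = x * c * x⁻¹ := by
      rintro _ ⟨c, hc, rfl⟩
      exact ⟨c, hc, rfl⟩
    obtain ⟨w, hw⟩ := hι.exists_conj_mem (L := C.map (MulAut.conj x).toMonoidHom) hC
      (fun l hl => by
        obtain ⟨c, hc, rfl⟩ := hmem l hl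
        exact hPC _ (Subgroup.Normal.conj_mem inferInstance _ (hCP hc) _))
      (Group.nilpotent_of_mulEquiv (C.equivMapOfInjective _ (MulAut.conj x).injective))
      (fun a ha => by
        obtain ⟨b, hb⟩ := hι.conj x⁻¹ a
        have hb0 : b = 0 := hfixC b fun c hc => by
          have := ha _ ⟨c, hc, rfl⟩
          have h2 : x * c * x⁻¹ * ι a = ι a * (x * c * x⁻¹) := this
          rw [hb]
          calc c * (x⁻¹ * ι a * x⁻¹⁻¹) = x⁻¹ * (x * c * x⁻¹ * ι a) * x := by group
            _ = _ := by rw [h2]; group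
        refine hι.eq_zero ?_
        rw [hb0, hι.map_zero] at hb
        have := congrArg (fun t => x * t * x⁻¹) hb
        simpa [mul_assoc] using this.symm)
    refine ⟨-w, ?_⟩
    rw [hι.map_neg]
    set y := (ι w)⁻¹ * x with hy
    have hyC : ∀ c ∈ C, y * c * y⁻¹ ∈ C := fun c hc => by
      have := hw _ ⟨c, hc, rfl⟩
      convert this using 1
      simp [hy, mul_assoc]
    rw [Subgroup.mem_normalizer_iff]
    refine fun h => ⟨hyC h, fun hh => ?_⟩
    have hhP : h ∈ P := by
      have := Subgroup.Normal.conj_mem (H := P) inferInstance _ (hCP hh) y⁻¹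
      simpa [mul_assoc] using this
    obtain ⟨b, hb⟩ := hPC h hhP
    obtain ⟨b', hb'⟩ := hι.conj y b
    have hb'C : ι b' ∈ C := by
      have := C.mul_mem (hyC _ hb) (C.inv_mem hh)
      rw [hb']
      convert this using 1
      group
    have hb0 : ι b = 1 := by
      rw [hC b' hb'C, hι.map_zero] at hb'
      have := congrArg (fun t => y⁻¹ * t * y) hb'
      simpa [mul_assoc] using this.symm
    rwa [hb0, one_mul] at hb
  · -- `⁅ι a, c⁆` lies in both `C` and `A`
    obtain ⟨b, hb⟩ := hι.conj c a
    have h1 : ι (a - b) ∈ C := by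
      have h2 := C.mul_mem ((Subgroup.mem_normalizer_iff.1 ha c).1 hc) (C.inv_mem hc)
      rw [hι.map_sub, hb]
      convert h2 using 1
      group
    have h2 := sub_eq_zero.1 (hC _ h1)
    rw [← h2] at hb
    exact mul_inv_eq_iff_eq_mul.1 hb.symm

/-! ### Supplements of rational normal subgroups -/

theorem conj_mem_relUpperCentral {G : Type*} [Group G] {P : Subgroup G} [P.Normal] {n : ℕ} {x : G}
    (hx : x ∈ relUpperCentral (P : Set G) {1} n) (g : G) :
    g * x * g⁻¹ ∈ relUpperCentral (P : Set G) {1} n :=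
  map_mem_relUpperCentral (MulAut.conj g).toMonoidHom
    (fun p hp => ⟨g⁻¹ * p * g, by
      simpa using Subgroup.Normal.conj_mem (H := P) inferInstance _ hp g⁻¹, by simp [mul_assoc]⟩)
    (by rintro _ rfl; simp) n x hx

/-- Passage to the quotient by a rational subspace of an embedded normal subgroup. -/
theorem IsNormalEmbedding.exists_quotient {Q A : Type*} [Group Q] [AddCommGroup A] [Module ℚ A]
    {ι : A → Q} (hι : IsNormalEmbedding ι) (W : Submodule ℚ A) {N : Subgroup Q} [N.Normal]
    (hN : ∀ x, x ∈ N ↔ ∃ a ∈ W, ι a = x) :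
    ∃ ι' : A ⧸ W → Q ⧸ N, IsNormalEmbedding ι' ∧
      ∀ a, ι' (W.mkQ a) = QuotientGroup.mk' N (ι a) := by
  have key : ∀ a b, QuotientGroup.mk' N (ι a) = QuotientGroup.mk' N (ι b) ↔
      W.mkQ a = W.mkQ b := fun a b => by
    rw [eq_comm, QuotientGroup.mk'_apply, QuotientGroup.mk'_apply, QuotientGroup.eq, hN,
      Submodule.mkQ_apply, Submodule.mkQ_apply, Submodule.Quotient.eq]
    constructor
    · rintro ⟨c, hc, h⟩
      rw [← hι.map_neg, ← hι.map_add, neg_add_eq_sub] at h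
      rwa [← hι.injective h]
    · exact fun h => ⟨_, h, by rw [← hι.map_neg, ← hι.map_add, neg_add_eq_sub]⟩
  have h0 : ∀ a, QuotientGroup.mk' N (ι (Function.surjInv W.mkQ_surjective (W.mkQ a))) =
      QuotientGroup.mk' N (ι a) := fun a =>
    (key _ _).2 (Function.surjInv_eq W.mkQ_surjective _)
  refine ⟨fun a => QuotientGroup.mk' N (ι (Function.surjInv W.mkQ_surjective a)),
    ⟨fun a b => ?_, fun a b h => ?_, fun g a => ?_⟩, h0⟩
  · obtain ⟨a, rfl⟩ := W.mkQ_surjective a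
    obtain ⟨b, rfl⟩ := W.mkQ_surjective b
    rw [← _root_.map_add, h0, h0, h0, hι.map_add, _root_.map_mul]
  · obtain ⟨a, rfl⟩ := W.mkQ_surjective a
    obtain ⟨b, rfl⟩ := W.mkQ_surjective b
    simp only [h0] at h
    exact (key _ _).1 h
  · obtain ⟨a, rfl⟩ := W.mkQ_surjective a
    obtain ⟨g, rfl⟩ := QuotientGroup.mk'_surjective N g
    obtain ⟨b, hb⟩ := hι.conj g a
    exact ⟨W.mkQ b, by simp only [h0, hb, _root_.map_mul, _root_.map_inv]⟩

/-- The vectors killed by a power of the augmentation ideal of `P` form a subspace, which is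
reached after finitely many steps. -/
theorem IsNormalEmbedding.exists_hypercentral_submodule {Q A : Type*} [Group Q] [AddCommGroup A]
    [Module ℚ A] [FiniteDimensional ℚ A] {ι : A → Q} (hι : IsNormalEmbedding ι)
    (P : Subgroup Q) :
    ∃ (W : Submodule ℚ A) (k : ℕ), (∀ a, a ∈ W ↔ ι a ∈ relUpperCentral (P : Set Q) {1} k) ∧
      ∀ a, (∀ p ∈ P, ⁅ι a, p⁆ ∈ relUpperCentral (P : Set Q) {1} k) → a ∈ W := by
  obtain ⟨ρ, hρ⟩ := hι.exists_representation
  let F : ℕ → Submodule ℚ A := fun k =>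
    Nat.rec ⊥ (fun _ W => ⨅ p : P, W.comap (1 - ρ p)) k
  have hF : ∀ k a, a ∈ F k ↔ ι a ∈ relUpperCentral (P : Set Q) {1} k := by
    intro k
    induction k with
    | zero =>
      intro a
      change a ∈ (⊥ : Submodule ℚ A) ↔ ι a = 1
      rw [Submodule.mem_bot, ← hι.map_zero, hι.injective.eq_iff]
    | succ k ih =>
      intro a
      change a ∈ ⨅ p : P, (F k).comap (1 - ρ p) ↔ ∀ p ∈ P, ⁅ι a, p⁆ ∈ _
      simp only [Submodule.mem_iInf, Submodule.mem_comap, ih, hι.commutator_eq hρ,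
        Subtype.forall]
      rfl
  have hmono : Monotone F := monotone_nat_of_le_succ fun k => by
    induction k with
    | zero => exact bot_le
    | succ k ih => exact iInf_mono fun p => Submodule.comap_mono ih
  obtain ⟨k, hk⟩ := monotone_stabilizes_iff_noetherian.2 (inferInstance : IsNoetherian ℚ A)
    ⟨F, hmono⟩
  refine ⟨F k, k, hF k, fun a ha => ?_⟩
  have h : F k = F (k + 1) := hk (k + 1) k.le_succ
  rw [h]
  exact (hF (k + 1) a).2 ha

/-- The case of an abelian rational normal subgroup.  Modulo the part of `A` on which `P` acts
nilpotently there are no fixed vectors, so the Frattini argument applies there. -/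
theorem IsNormalEmbedding.exists_nilpotent_supplement {Q A : Type*} [Group Q] [AddCommGroup A]
    [Module ℚ A] [FiniteDimensional ℚ A] {ι : A → Q} (hι : IsNormalEmbedding ι) {P L : Subgroup Q}
    [P.Normal] (hιP : ∀ a, ι a ∈ P) {n : ℕ}
    (hn : ∀ p ∈ P, p ∈ relUpperCentral (P : Set Q) (Set.range ι) n)
    (hLP : L ≤ P) (hL : Group.IsNilpotent L)
    (hcases : L = ⊥ ∨ ∀ p ∈ P, ∃ l ∈ L, ∀ a, p * ι a * p⁻¹ = l * ι a * l⁻¹) :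
    ∃ Q₀ : Subgroup Q, L ≤ Q₀ ∧ Group.IsNilpotent (P ⊓ Q₀ : Subgroup Q) ∧
      ∀ x, ∃ a, ι a * x ∈ Q₀ := by
  obtain ⟨W, k, hW, hWfix⟩ := hι.exists_hypercentral_submodule P
  let N : Subgroup Q :=
    { carrier := {x | ∃ a ∈ W, ι a = x}
      one_mem' := ⟨0, W.zero_mem, hι.map_zero⟩
      mul_mem' := by
        rintro _ _ ⟨a, ha, rfl⟩ ⟨b, hb, rfl⟩
        exact ⟨a + b, W.add_mem ha hb, hι.map_add a b⟩
      inv_mem' := by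
        rintro _ ⟨a, ha, rfl⟩
        exact ⟨-a, W.neg_mem ha, hι.map_neg a⟩ }
  have hN : ∀ x, x ∈ N ↔ ∃ a ∈ W, ι a = x := fun x => Iff.rfl
  have hNnormal : N.Normal := ⟨by
    rintro _ ⟨a, ha, rfl⟩ g
    obtain ⟨b, hb⟩ := hι.conj g a
    refine ⟨b, (hW b).2 ?_, hb⟩
    rw [hb]
    exact conj_mem_relUpperCentral ((hW a).1 ha) g⟩
  have hNk : ∀ x ∈ N, x ∈ relUpperCentral (P : Set Q) {1} k := by
    rintro _ ⟨a, ha, rfl⟩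
    exact (hW a).1 ha
  have hNι : ∀ a, ι a ∈ N ↔ a ∈ W := fun a =>
    ⟨by rintro ⟨b, hb, h⟩; rwa [← hι.injective h], fun h => ⟨a, h, rfl⟩⟩
  obtain ⟨ι', hι', hι'mk⟩ := hι.exists_quotient W hN
  set π := QuotientGroup.mk' N with hπ
  have hπN : ∀ x, π x = 1 ↔ x ∈ N := fun x => QuotientGroup.eq_one_iff x
  have hP' : (P.map π).Normal :=
    Subgroup.Normal.map inferInstance π (QuotientGroup.mk'_surjective N)
  have hfixP : ∀ a, (∀ p ∈ P, π p * π (ι a) = π (ι a) * π p) → W.mkQ a = 0 := fun a ha => by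
    rw [Submodule.mkQ_apply, Submodule.Quotient.mk_eq_zero]
    refine hWfix a fun p hp => hNk _ ((hπN _).1 ?_)
    rw [map_commutatorElement, commutatorElement_eq_one_iff_mul_comm, ha p hp]
  obtain ⟨Q₁, hLQ₁, hQ₁, hQ₁ι⟩ := hι'.exists_complement_of_normal (P := P.map π) (L := L.map π)
    (n := n)
    (fun a => by
      obtain ⟨a, rfl⟩ := W.mkQ_surjective a
      rw [hι'mk]
      exact ⟨_, hιP a, rfl⟩)
    (by
      rintro _ ⟨p, hp, rfl⟩
      refine map_mem_relUpperCentral π (fun _ h => h) ?_ n p (hn p hp)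
      rintro _ ⟨a, rfl⟩
      exact ⟨W.mkQ a, hι'mk a⟩)
    (fun a ha => by
      obtain ⟨a, rfl⟩ := W.mkQ_surjective a
      rw [hι'mk] at ha
      exact hfixP a fun p hp => ha _ ⟨p, hp, rfl⟩)
    (Subgroup.map_mono hLP)
    (Group.nilpotent_of_surjective _ (π.subgroupMap_surjective L))
    (by
      refine hcases.imp (fun h => by rw [h, Subgroup.map_bot]) fun h a ha => ?_
      obtain ⟨a, rfl⟩ := W.mkQ_surjective a
      rw [hι'mk] at ha
      refine hfixP a fun p hp => ?_
      obtain ⟨l, hl, hpl⟩ := h p hp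
      have h1 := ha _ ⟨l, hl, rfl⟩
      rw [← mul_inv_eq_iff_eq_mul] at h1 ⊢
      rw [← _root_.map_mul, ← _root_.map_inv, ← _root_.map_mul, hpl a]
      simpa only [_root_.map_mul, _root_.map_inv] using h1)
  refine ⟨Q₁.comap π, Subgroup.map_le_iff_le_comap.1 hLQ₁, ?_, fun x => ?_⟩
  · set D := P ⊓ Q₁.comap π with hD
    refine isNilpotent_iff_relUpperCentral.2 ⟨k + n, fun g => ?_⟩
    refine relUpperCentral_subset_add (S := {x : D | (x : Q) ∈ N}) ?_ n ?_
    · exact fun x hx => mem_relUpperCentral_of_map D.subtype (fun p _ => p.2.1)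
        (fun s hs => Subtype.ext hs) k x (hNk _ hx)
    · refine mem_relUpperCentral_of_map D.subtype (fun p _ => p.2.1) ?_ n g (hn g g.2.1)
      rintro s ⟨a, ha⟩
      have h1 : ι' (W.mkQ a) ∈ Q₁ := by
        rw [hι'mk, ha]
        exact s.2.2
      have h2 := hQ₁ι _ h1
      rw [Submodule.mkQ_apply, Submodule.Quotient.mk_eq_zero, ← hNι, ha] at h2
      exact h2
  · obtain ⟨a, ha⟩ := hQ₁ (π x)
    obtain ⟨a, rfl⟩ := W.mkQ_surjective a
    rw [hι'mk, ← _root_.map_mul] at ha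
    exact ⟨a, ha⟩

/-! ### Torsion-free rank and rational structure -/

/-- An abelian group with bijective multiplication by positive integers is a rational vector space,
of dimension its torsion-free rank. -/
theorem exists_rat_module {V : Type*} [AddCommGroup V]
    (hdiv : ∀ n : ℕ, 0 < n → Function.Bijective fun x : V => n • x)
    (hrank : Module.rank ℤ V < Cardinal.aleph0) :
    ∃ _ : Module ℚ V, FiniteDimensional ℚ V := by
  have hinj : ∀ n : ℤ, n ≠ 0 → ∀ a b : V, n • a = n • b → a = b := fun n hn a b hab => by
    refine (hdiv n.natAbs (Int.natAbs_pos.2 hn)).1 ?_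
    change n.natAbs • a = n.natAbs • b
    rw [← natCast_zsmul, ← natCast_zsmul]
    rcases Int.natAbs_eq n with h | h
    · rwa [← h]
    · rw [h, neg_smul, neg_smul] at hab
      exact neg_injective hab
  choose s hs using fun (q : ℚ) (v : V) => (hdiv q.den q.den_pos).2 (q.num • v)
  -- `s q v` is determined by any representation of `q` as a fraction `m / n`
  have key : ∀ (q : ℚ) (v w : V) (n m : ℤ), n ≠ 0 → q * n = m → n • w = m • v → s q v = w := by
    intro q v w n m hn hq hw
    have hs' : (q.den : ℤ) • s q v = q.num • v := by rw [natCast_zsmul]; exact hs q v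
    have hqd : q.num * n = m * q.den := by
      have h1 : (q.num : ℚ) = q * q.den := (Rat.mul_den_eq_num q).symm
      have h2 : (q.num : ℚ) * n = m * q.den := by rw [h1, ← hq]; ring
      exact_mod_cast h2
    refine hinj (n * q.den) (mul_ne_zero hn (by exact_mod_cast q.den_nz)) _ _ ?_
    rw [mul_smul, hs', mul_comm, mul_smul, hw, ← mul_smul, ← mul_smul, mul_comm n, hqd, mul_comm]
  have hd : ∀ q : ℚ, (q.den : ℤ) ≠ 0 := fun q => by exact_mod_cast q.den_nz
  have hs' : ∀ q v, (q.den : ℤ) • s q v = q.num • v := fun q v => by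
    rw [natCast_zsmul]; exact hs q v
  have hqd : ∀ q : ℚ, q * ((q.den : ℤ) : ℚ) = (q.num : ℚ) := fun q => by
    simp
  let inst : Module ℚ V :=
    { smul := s
      one_smul := fun v => key 1 v v 1 1 one_ne_zero (by norm_num) rfl
      mul_smul := fun q r v => key (q * r) v _ (r.den * q.den) (r.num * q.num)
        (mul_ne_zero (hd r) (hd q)) (by
          rw [Int.cast_mul, Int.cast_mul, ← hqd q, ← hqd r]; ring) (by
          change _ • s q (s r v) = _
          rw [mul_smul, hs' q, smul_comm, hs' r, ← mul_smul, mul_comm])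
      smul_zero := fun q => key q 0 0 q.den q.num (hd q) (hqd q) (by simp)
      smul_add := fun q a b => key q _ _ q.den q.num (hd q) (hqd q) (by
          change _ • (s q a + s q b) = _
          rw [smul_add, hs', hs', smul_add])
      add_smul := fun q r v => key (q + r) v _ (q.den * r.den) (q.num * r.den + q.den * r.num)
        (mul_ne_zero (hd q) (hd r)) (by
          push_cast [← hqd q, ← hqd r]; ring) (by
          change _ • (s q v + s r v) = _
          rw [smul_add, mul_comm, mul_smul, hs' q, mul_comm, mul_smul, hs' r, add_smul, mul_smul,
            mul_smul, smul_comm q.num])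
      zero_smul := fun v => key 0 v 0 1 0 one_ne_zero (by simp) (by simp) }
  refine ⟨inst, Module.rank_lt_aleph0_iff.1 ?_⟩
  rwa [IsLocalization.rank_eq ℚ (nonZeroDivisors ℤ) le_rfl]

/-- The factors of the derived series of `G` all have finite torsion-free rank. -/
def HasFiniteDerivedRanks (G : Type u) [Group G] : Prop :=
  ∀ i, Module.rank ℤ (Additive (Abelianization (derivedSeries G i))) < Cardinal.aleph0

theorem hasFiniteDerivedRanks_of_hirschLength_lt_top {G : Type u} [Group G]
    (h : hirschLength G < ⊤) : HasFiniteDerivedRanks G := fun i =>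
  (Cardinal.le_sum (fun i : ℕ => Module.rank ℤ (Additive (Abelianization (derivedSeries G i))))
    i).trans_lt (Cardinal.toENat_lt_top.1 h)

theorem HasFiniteDerivedRanks.of_surjective {G H : Type u} [Group G] [Group H]
    (hG : HasFiniteDerivedRanks G) (φ : G →* H) (hφ : Function.Surjective φ) :
    HasFiniteDerivedRanks H := fun i => by
  have hmap := map_derivedSeries_eq hφ i
  let ψ : derivedSeries G i →* derivedSeries H i :=
    (φ.comp (derivedSeries G i).subtype).codRestrict _ fun x => by
      rw [← hmap]; exact ⟨x, x.2, rfl⟩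
  have hψ : Function.Surjective ψ := by
    rintro ⟨y, hy⟩
    rw [← hmap] at hy
    obtain ⟨x, hx, rfl⟩ := hy
    exact ⟨⟨x, hx⟩, rfl⟩
  refine (LinearMap.rank_le_of_surjective
    (MonoidHom.toAdditive (Abelianization.map ψ)).toIntLinearMap ?_).trans_lt (hG i)
  intro y
  obtain ⟨y, rfl⟩ := QuotientGroup.mk_surjective (Additive.toMul y)
  obtain ⟨x, rfl⟩ := hψ y
  exact ⟨Additive.ofMul (Abelianization.of x), rfl⟩

/-- Abelian subgroups of solvable groups whose derived series has factors of finite rank have finite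
rank. -/
theorem HasFiniteDerivedRanks.rank_lt_aleph0 {G : Type u} [Group G] [Group.IsSolvable G]
    (hG : HasFiniteDerivedRanks G) {B : Type u} [AddCommGroup B] (φ : B →+ Additive G)
    (hφ : Function.Injective φ) : Module.rank ℤ B < Cardinal.aleph0 := by
  obtain ⟨n, hn⟩ := Group.IsSolvable.solvable (G := G)
  suffices H : ∀ (j i : ℕ), i + j = n → ∀ {B : Type u} [AddCommGroup B] (φ : B →+ Additive G),
      Function.Injective φ → (∀ b, (φ b).toMul ∈ derivedSeries G i) →
      Module.rank ℤ B < Cardinal.aleph0 from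
    H n 0 (zero_add n) φ hφ fun _ => trivial
  intro j
  induction j with
  | zero =>
    intro i hi B _ φ hφ hmem
    have : Subsingleton B := ⟨fun a b => hφ <| by
      have h : ∀ b, (φ b).toMul = 1 := fun b => by
        have := hmem b
        rwa [← add_zero i, hi, hn, Subgroup.mem_bot] at this
      exact Additive.toMul.injective ((h a).trans (h b).symm)⟩
    exact (rank_subsingleton' ℤ B).trans_lt Cardinal.aleph0_pos
  | succ j ih =>
    intro i hi B _ φ hφ hmem
    let f : B →ₗ[ℤ] Additive (Abelianization (derivedSeries G i)) :=
      (AddMonoidHom.mk' (fun b => Additive.ofMul (Abelianization.of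
        (⟨(φ b).toMul, hmem b⟩ : derivedSeries G i))) fun a b => by
          rw [← ofMul_mul, ← _root_.map_mul]
          congr 2
          exact Subtype.ext (congrArg Additive.toMul (map_add φ a b))).toIntLinearMap
    rw [← LinearMap.rank_range_add_rank_ker f]
    refine Cardinal.add_lt_aleph0 ((Submodule.rank_le _).trans_lt (hG i)) ?_
    refine ih (i + 1) (by omega) (φ.comp (LinearMap.ker f).subtype.toAddMonoidHom)
      (hφ.comp Subtype.val_injective) fun b => ?_
    have h : (⟨(φ b).toMul, hmem b⟩ : derivedSeries G i) ∈ commutator (derivedSeries G i) :=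
      (QuotientGroup.eq_one_iff _).1 (congrArg Additive.toMul (LinearMap.mem_ker.1 b.2))
    rw [derivedSeries_succ, ← Subgroup.map_subtype_commutator]
    exact ⟨_, h, rfl⟩

/-! ### Mal'cev complete normal subgroups -/

theorem relUpperCentral_succ_subset {G : Type*} [Group G] (P S : Set G) (n : ℕ) :
    relUpperCentral P S (n + 1) ⊆ relUpperCentral P (relUpperCentral P S 1) n := by
  induction n with
  | zero => exact subset_rfl
  | succ n ih => exact fun x hx p hp => ih (hx p hp)

/-- Unique divisibility passes to the quotient by the centre, because roots of central elements are
central. -/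
theorem pow_bijective_of_surjective_of_ker_eq_center {G H : Type*} [Group G] [Group H]
    (hG : ∀ n : ℕ, 0 < n → Function.Bijective fun x : G => x ^ n) (φ : G →* H)
    (hφ : Function.Surjective φ) (hker : ∀ x, φ x = 1 ↔ x ∈ Subgroup.center G) (n : ℕ)
    (hn : 0 < n) : Function.Bijective fun x : H => x ^ n := by
  constructor
  · intro x y hxy
    obtain ⟨x, rfl⟩ := hφ x
    obtain ⟨y, rfl⟩ := hφ y
    have hxy' : φ (x ^ n) = φ (y ^ n) := by simpa using hxy
    have hz : (y ^ n)⁻¹ * x ^ n ∈ Subgroup.center G := by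
      rw [← hker, map_mul, map_inv, hxy', inv_mul_cancel]
    obtain ⟨w, hw⟩ := (hG n hn).2 ((y ^ n)⁻¹ * x ^ n)
    have hw : w ^ n = (y ^ n)⁻¹ * x ^ n := hw
    have hwc : w ∈ Subgroup.center G := Subgroup.mem_center_iff.2 fun g => by
      have h1 : (g * w * g⁻¹) ^ n = w ^ n := by
        rw [conj_pow, hw, Subgroup.mem_center_iff.1 hz g, mul_inv_cancel_right]
      exact mul_inv_eq_iff_eq_mul.1 ((hG n hn).1 h1)
    have h2 : x = y * w := (hG n hn).1 <| by
      change x ^ n = (y * w) ^ n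
      rw [(show Commute y w from Subgroup.mem_center_iff.1 hwc y).mul_pow, hw, mul_inv_cancel_left]
    rw [h2, map_mul, (hker w).2 hwc, mul_one]
  · intro y
    obtain ⟨x, rfl⟩ := hφ y
    obtain ⟨w, hw⟩ := (hG n hn).2 x
    exact ⟨φ w, by simp only [← map_pow]; exact congrArg φ hw⟩

theorem pow_bijective_center {G : Type*} [Group G]
    (hG : ∀ n : ℕ, 0 < n → Function.Bijective fun x : G => x ^ n) (n : ℕ) (hn : 0 < n) :
    Function.Bijective fun x : Subgroup.center G => x ^ n := by
  refine ⟨fun x y h => Subtype.ext ((hG n hn).1 (congrArg Subtype.val h)), fun z => ?_⟩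
  obtain ⟨w, hw⟩ := (hG n hn).2 z
  have hw : w ^ n = z := hw
  refine ⟨⟨w, Subgroup.mem_center_iff.2 fun g => ?_⟩, Subtype.ext hw⟩
  have h1 : (g * w * g⁻¹) ^ n = w ^ n := by
    rw [conj_pow, hw, Subgroup.mem_center_iff.1 z.2 g, mul_inv_cancel_right]
  exact mul_inv_eq_iff_eq_mul.1 ((hG n hn).1 h1)

open scoped IsMulCommutative in
/-- The centre of a normal Mal'cev complete subgroup of finite Hirsch length is a
finite-dimensional rational normal subgroup. -/
theorem exists_isNormalEmbedding_center {Q : Type u} [Group Q] (M : Subgroup Q) [M.Normal]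
    [Group.IsSolvable M] (hM : ∀ n : ℕ, 0 < n → Function.Bijective fun x : M => x ^ n)
    (hrank : HasFiniteDerivedRanks M) :
    ∃ (A : Type u) (_ : AddCommGroup A) (_ : Module ℚ A) (_ : FiniteDimensional ℚ A) (ι : A → Q),
      IsNormalEmbedding ι ∧ Set.range ι = (Subgroup.center M).map M.subtype := by
  obtain ⟨hmod, hfin⟩ := exists_rat_module (V := Additive (Subgroup.center M))
    (pow_bijective_center hM)
    (hrank.rank_lt_aleph0 (MonoidHom.toAdditive (Subgroup.center M).subtype)
      Subtype.val_injective)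
  have hnormal : ((Subgroup.center M).map M.subtype).Normal := inferInstance
  refine ⟨Additive (Subgroup.center M), inferInstance, hmod, hfin,
    fun z => ((z.toMul : M) : Q), ⟨fun a b => rfl, fun a b h => ?_, fun g a => ?_⟩, ?_⟩
  · exact Additive.toMul.injective (Subtype.ext (Subtype.ext h))
  · obtain ⟨z, hz, h⟩ := hnormal.conj_mem _ ⟨a.toMul, a.toMul.2, rfl⟩ g
    exact ⟨Additive.ofMul ⟨z, hz⟩, h⟩
  · ext x
    constructor
    · rintro ⟨z, rfl⟩
      exact ⟨z.toMul, z.toMul.2, rfl⟩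
    · rintro ⟨z, hz, rfl⟩
      exact ⟨Additive.ofMul ⟨z, hz⟩, rfl⟩

/-- Induction on the nilpotency class of `M`: a supplement modulo the centre of `M` is cut down by
the case of an abelian normal subgroup.  A nilpotent `P/M` is assumed in
both cases of the last hypothesis. -/
theorem exists_nilpotent_supplement (c : ℕ) : ∀ {Q : Type u} [Group Q] (L M P : Subgroup Q)
    [M.Normal] [P.Normal], M ≤ P → L ≤ P →
    (∀ n : ℕ, 0 < n → Function.Bijective fun x : M => x ^ n) → HasFiniteDerivedRanks M →
    (∀ m : M, m ∈ relUpperCentral Set.univ {1} c) →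
    (∃ n, ∀ p ∈ P, p ∈ relUpperCentral (P : Set Q) (M : Set Q) n) → Group.IsNilpotent L →
    (L = ⊥ ∨ ∀ p ∈ P, ∃ l ∈ L, ∃ m ∈ M, p = l * m) →
    ∃ Q₀ : Subgroup Q, L ≤ Q₀ ∧ Group.IsNilpotent (P ⊓ Q₀ : Subgroup Q) ∧
      ∀ x, ∃ m ∈ M, m * x ∈ Q₀ := by
  induction c with
  | zero =>
    intro Q _ L M P _ _ _ _ _ _ hc ⟨n, hn⟩ _ _
    refine ⟨⊤, le_top, isNilpotent_iff_relUpperCentral.2 ⟨n, fun g => ?_⟩,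
      fun x => ⟨1, M.one_mem, trivial⟩⟩
    exact mem_relUpperCentral_of_map (P ⊓ ⊤ : Subgroup Q).subtype (fun p _ => p.2.1)
      (fun s hs => by
        have h : (⟨s, hs⟩ : M) = 1 := hc ⟨s, hs⟩
        have h' : (s : Q) = 1 := congrArg M.subtype h
        exact Subtype.ext h') n g (hn g g.2.1)
  | succ c ih =>
    intro Q _ L M P _ _ hMP hLP hM hrank hc ⟨n, hn⟩ hL hcases
    have : Group.IsNilpotent M := isNilpotent_iff_relUpperCentral.2 ⟨_, hc⟩
    obtain ⟨A, _, _, _, ι, hι, hιZ⟩ := exists_isNormalEmbedding_center M hM hrank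
    set Z := (Subgroup.center M).map M.subtype with hZ
    have hZM : Z ≤ M := Subgroup.map_subtype_le _
    have hιZ' : ∀ a, ι a ∈ Z := fun a => by
      have : ι a ∈ (Z : Set Q) := hιZ ▸ ⟨a, rfl⟩
      exact this
    have hMι : ∀ m ∈ M, ∀ a, m * ι a * m⁻¹ = ι a := fun m hm a => by
      obtain ⟨z, hz, h⟩ := hιZ' a
      have h1 : m * (z : Q) = z * m :=
        congrArg Subtype.val (Subgroup.mem_center_iff.1 hz ⟨m, hm⟩)
      rw [← h]
      exact mul_inv_eq_iff_eq_mul.2 h1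
    let π := QuotientGroup.mk' Z
    have hπ : ∀ x, π x = 1 ↔ x ∈ Z := fun x => QuotientGroup.eq_one_iff x
    have hπs : Function.Surjective π := QuotientGroup.mk'_surjective Z
    have hM' : (M.map π).Normal := Subgroup.Normal.map inferInstance π hπs
    have hP' : (P.map π).Normal := Subgroup.Normal.map inferInstance π hπs
    have hφ := π.subgroupMap_surjective M
    have hφker : ∀ m, π.subgroupMap M m = 1 ↔ m ∈ Subgroup.center M := fun m => by
      rw [← OneMemClass.coe_eq_one]
      change π m = 1 ↔ _
      rw [hπ]
      exact ⟨by rintro ⟨z, hz, h⟩; rwa [← Subtype.ext h], fun h => ⟨m, h, rfl⟩⟩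
    obtain ⟨Q₁', hLQ₁, hnil, hQ₁M⟩ := ih (L.map π) (M.map π) (P.map π) (Subgroup.map_mono hMP)
      (Subgroup.map_mono hLP) (pow_bijective_of_surjective_of_ker_eq_center hM _ hφ hφker)
      (hrank.of_surjective _ hφ)
      (fun m' => by
        obtain ⟨m, rfl⟩ := hφ m'
        refine map_mem_relUpperCentral _ (P := Set.univ)
          (S := relUpperCentral Set.univ {1} 1) ?_ ?_ c m (relUpperCentral_succ_subset _ _ _ (hc m))
        · rw [Set.image_univ_of_surjective hφ]
        · intro s hs
          refine (hφker s).2 (Subgroup.mem_center_iff.2 fun g => ?_)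
          exact (commutatorElement_eq_one_iff_mul_comm.1 (hs g trivial)).symm)
      ⟨n, by
        rintro _ ⟨p, hp, rfl⟩
        exact map_mem_relUpperCentral π (S := M) (S' := M.map π) (fun _ h => h)
          (fun s hs => ⟨s, hs, rfl⟩) n p (hn p hp)⟩
      (Group.nilpotent_of_surjective _ (π.subgroupMap_surjective L))
      (hcases.imp (fun h => by rw [h, Subgroup.map_bot]) fun h => by
        rintro _ ⟨p, hp, rfl⟩
        obtain ⟨l, hl, m, hm, rfl⟩ := h p hp
        exact ⟨_, ⟨l, hl, rfl⟩, _, ⟨m, hm, rfl⟩, map_mul π l m⟩)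
    set Q₁ := Q₁'.comap π with hQ₁
    have hLQ₁ : L ≤ Q₁ := Subgroup.map_le_iff_le_comap.1 hLQ₁
    have hιQ₁ : ∀ a, ι a ∈ Q₁ := fun a => by
      change π (ι a) ∈ Q₁'
      rw [(hπ _).2 (hιZ' a)]
      exact Q₁'.one_mem
    let ι₁ : A → Q₁ := fun a => ⟨ι a, hιQ₁ a⟩
    have hι₁ : IsNormalEmbedding ι₁ :=
      { map_add := fun a b => Subtype.ext (hι.map_add a b)
        injective := fun a b h => hι.injective (congrArg Subtype.val h)
        conj := fun g a => by
          obtain ⟨b, hb⟩ := hι.conj g a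
          exact ⟨b, Subtype.ext hb⟩ }
    obtain ⟨k, hk⟩ := isNilpotent_iff_relUpperCentral.1 hnil
    obtain ⟨Q₀, hLQ₀, hnil₀, hQ₀⟩ := hι₁.exists_nilpotent_supplement (P := P.subgroupOf Q₁)
      (L := L.subgroupOf Q₁) (n := k) (fun a => hMP (hZM (hιZ' a)))
      (fun p hp => by
        have h1 : π p ∈ relUpperCentral ((P.map π ⊓ Q₁' : Subgroup _) : Set (Q ⧸ Z)) {1} k :=
          map_mem_relUpperCentral (P.map π ⊓ Q₁' : Subgroup _).subtype (S := {1})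
            (fun q hq => ⟨⟨q, hq⟩, Set.mem_univ _, rfl⟩) (by rintro _ rfl; rfl) k
            ⟨π p, ⟨p, hp, rfl⟩, p.2⟩ (hk _)
        refine mem_relUpperCentral_of_map (π.comp Q₁.subtype) ?_ ?_ k p h1
        · exact fun q hq => ⟨⟨q, hq, rfl⟩, q.2⟩
        · intro s hs
          have hsZ : (s : Q) ∈ (Z : Set Q) := (hπ _).1 hs
          rw [← hιZ] at hsZ
          obtain ⟨a, ha⟩ := hsZ
          exact ⟨a, Subtype.ext ha⟩)
      (Subgroup.comap_mono hLP)
      (Group.nilpotent_of_mulEquiv (Subgroup.subgroupOfEquivOfLe hLQ₁).symm)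
      (by
        refine hcases.imp (fun h => by rw [h, Subgroup.bot_subgroupOf]) fun h p hp => ?_
        obtain ⟨l, hl, m, hm, hlm⟩ := h p hp
        refine ⟨⟨l, hLQ₁ hl⟩, hl, fun a => Subtype.ext ?_⟩
        change (p : Q) * ι a * (p : Q)⁻¹ = l * ι a * l⁻¹
        conv_rhs => rw [← hMι m hm a]
        rw [hlm]
        group)
    refine ⟨Q₀.map Q₁.subtype, fun l hl => ⟨⟨l, hLQ₁ hl⟩, hLQ₀ hl, rfl⟩, ?_, fun x => ?_⟩
    · have hmap : P ⊓ Q₀.map Q₁.subtype = (P.subgroupOf Q₁ ⊓ Q₀).map Q₁.subtype := by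
        ext x
        constructor
        · rintro ⟨hx, y, hy, rfl⟩
          exact ⟨y, ⟨hx, hy⟩, rfl⟩
        · rintro ⟨y, ⟨hx, hy⟩, rfl⟩
          exact ⟨hx, y, hy, rfl⟩
      rw [hmap]
      exact Group.nilpotent_of_mulEquiv
        ((P.subgroupOf Q₁ ⊓ Q₀).equivMapOfInjective _ Q₁.subtype_injective)
    · obtain ⟨_, ⟨m, hm, rfl⟩, h⟩ := hQ₁M (π x)
      rw [← map_mul] at h
      obtain ⟨a, ha⟩ := hQ₀ ⟨m * x, h⟩
      exact ⟨ι a * m, M.mul_mem (hZM (hιZ' a)) hm, _, ha, (mul_assoc _ _ _).symm⟩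

/-- If `Q/M` and `L` are finitely generated, then a supplement of `M` containing `L` contains a
finitely generated one. -/
theorem exists_fg_supplement {Q : Type*} [Group Q] {L M Q₀ : Subgroup Q} [M.Normal]
    (hLQ₀ : L ≤ Q₀) (hQ₀ : ∀ x, ∃ m ∈ M, m * x ∈ Q₀) (hQM : Group.FG (Q ⧸ M)) (hL : Group.FG L) :
    ∃ Q₁ ≤ Q₀, L ≤ Q₁ ∧ (∀ x, ∃ m ∈ M, m * x ∈ Q₁) ∧ Group.FG Q₁ := by
  obtain ⟨s, hs⟩ := (Group.fg_iff_subgroup_fg L).1 hL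
  obtain ⟨t, ht⟩ := (Group.fg_def.1 hQM : (⊤ : Subgroup (Q ⧸ M)).FG)
  have hlift : ∀ y : Q ⧸ M, ∃ x ∈ Q₀, QuotientGroup.mk' M x = y := fun y => by
    obtain ⟨x, rfl⟩ := QuotientGroup.mk'_surjective M y
    obtain ⟨m, hm, h⟩ := hQ₀ x
    refine ⟨m * x, h, ?_⟩
    have h1 : QuotientGroup.mk' M m = 1 := (QuotientGroup.eq_one_iff m).2 hm
    rw [map_mul, h1, one_mul]
  choose r hr hr' using hlift
  classical
  refine ⟨Subgroup.closure (s ∪ t.image r : Finset Q), ?_, ?_, fun x => ?_, ?_⟩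
  · rw [Subgroup.closure_le]
    intro x hx
    simp only [Finset.coe_union, Set.mem_union, Finset.mem_coe, Finset.mem_image] at hx
    rcases hx with hx | ⟨y, -, rfl⟩
    · exact hLQ₀ (hs ▸ Subgroup.subset_closure hx)
    · exact hr y
  · rw [← hs]
    exact Subgroup.closure_mono (by simp)
  · have hmap : (Subgroup.closure (s ∪ t.image r : Finset Q) : Subgroup Q).map
        (QuotientGroup.mk' M) = ⊤ := by
      rw [eq_top_iff, ← ht, Subgroup.closure_le]
      intro y hy
      refine ⟨r y, Subgroup.subset_closure ?_, hr' y⟩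
      rw [Finset.mem_coe]
      exact Finset.mem_union_right _ (Finset.mem_image_of_mem r hy)
    obtain ⟨q, hq, hqx⟩ : QuotientGroup.mk' M x ∈ (Subgroup.closure
        (s ∪ t.image r : Finset Q) : Subgroup Q).map (QuotientGroup.mk' M) := hmap ▸ trivial
    refine ⟨q * x⁻¹, ?_, by rwa [inv_mul_cancel_right]⟩
    refine (QuotientGroup.eq_one_iff _).1 ?_
    change QuotientGroup.mk' M (q * x⁻¹) = 1
    rw [map_mul, hqx, map_inv, mul_inv_cancel]
  · exact (Group.fg_iff_subgroup_fg _).2 ⟨_, rfl⟩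

theorem theoremB {Q : Type*} [Group Q] (L M P : Subgroup Q)
    [M.Normal] [P.Normal]
    (hLM : (L : Set Q) * (M : Set Q) ⊆ (P : Set Q))
    (hM : IsMalcevComplete M) (hMfin : hirschLength M < ⊤)
    (hcases : (L = ⊥ ∧ Group.IsNilpotent (P ⧸ M.subgroupOf P)) ∨
      ((L : Set Q) * (M : Set Q) = (P : Set Q) ∧ Group.IsNilpotent L)) :
    (∃ Q₀ : Subgroup Q, L ≤ Q₀ ∧ Group.IsNilpotent (P ⊓ Q₀ : Subgroup Q) ∧
      (Q₀ : Set Q) * (M : Set Q) = Set.univ) ∧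
    (Group.FG (Q ⧸ M) → Group.FG L →
      ∃ Q₀ : Subgroup Q, L ≤ Q₀ ∧ Group.IsNilpotent (P ⊓ Q₀ : Subgroup Q) ∧
        (Q₀ : Set Q) * (M : Set Q) = Set.univ ∧ Group.FG Q₀) := by
  have hMP : M ≤ P := fun m hm => hLM ⟨1, L.one_mem, m, hm, one_mul m⟩
  have hLP : L ≤ P := fun l hl => hLM ⟨l, hl, 1, M.one_mem, mul_one l⟩
  have hdecomp : (L : Set Q) * (M : Set Q) = (P : Set Q) → ∀ p ∈ P, ∃ l ∈ L, ∃ m ∈ M, p = l * m :=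
    fun h p hp => by
      obtain ⟨l, hl, m, hm, rfl⟩ : p ∈ (L : Set Q) * (M : Set Q) := h ▸ hp
      exact ⟨l, hl, m, hm, rfl⟩
  have hL : Group.IsNilpotent L := by
    rcases hcases with ⟨rfl, -⟩ | ⟨-, h⟩
    · infer_instance
    · exact h
  have hPM : Group.IsNilpotent (P ⧸ M.subgroupOf P) := by
    rcases hcases with ⟨-, h⟩ | ⟨h, -⟩
    · exact h
    · refine Group.nilpotent_of_surjective
        ((QuotientGroup.mk' (M.subgroupOf P)).comp (Subgroup.inclusion hLP)) fun y => ?_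
      obtain ⟨p, rfl⟩ := QuotientGroup.mk'_surjective _ y
      obtain ⟨l, hl, m, hm, hp⟩ := hdecomp h p p.2
      refine ⟨⟨l, hl⟩, QuotientGroup.eq.2 ?_⟩
      change l⁻¹ * (p : Q) ∈ M
      rwa [hp, inv_mul_cancel_left]
  have hPM' : ∃ n, ∀ p ∈ P, p ∈ relUpperCentral (P : Set Q) (M : Set Q) n := by
    obtain ⟨n, hn⟩ := isNilpotent_iff_relUpperCentral.1 hPM
    refine ⟨n, fun p hp => ?_⟩
    have h1 : (⟨p, hp⟩ : P) ∈ relUpperCentral Set.univ (M.subgroupOf P : Set P) n :=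
      mem_relUpperCentral_of_map (QuotientGroup.mk' (M.subgroupOf P)) (fun _ _ => Set.mem_univ _)
        (fun s hs => (QuotientGroup.eq_one_iff s).1 hs) n _ (hn _)
    exact map_mem_relUpperCentral P.subtype (fun q hq => ⟨⟨q, hq⟩, Set.mem_univ _, rfl⟩)
      (fun _ hs => hs) n _ h1
  obtain ⟨c, hc⟩ := isNilpotent_iff_relUpperCentral.1 hM.isNilpotent
  obtain ⟨Q₀, hLQ₀, hnil, hQ₀⟩ := exists_nilpotent_supplement c L M P hMP hLP hM.pow_bijective
    (hasFiniteDerivedRanks_of_hirschLength_lt_top hMfin) hc hPM' hL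
    (hcases.imp And.left fun h => hdecomp h.1)
  have hmul : ∀ R : Subgroup Q, (∀ x, ∃ m ∈ M, m * x ∈ R) →
      (R : Set Q) * (M : Set Q) = Set.univ := fun R hR => Set.eq_univ_of_forall fun x => by
    obtain ⟨m, hm, h⟩ := hR x
    exact ⟨m * x, h, x⁻¹ * m⁻¹ * x, by
      simpa using Subgroup.Normal.conj_mem (H := M) inferInstance _ (M.inv_mem hm) x⁻¹, by group⟩
  refine ⟨⟨Q₀, hLQ₀, hnil, hmul Q₀ hQ₀⟩, fun hQM hLfg => ?_⟩
  obtain ⟨Q₁, hle, hLQ₁, hQ₁, hfg⟩ := exists_fg_supplement hLQ₀ hQ₀ hQM hLfg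
  refine ⟨Q₁, hLQ₁, ?_, hmul Q₁ hQ₁, hfg⟩
  exact Group.nilpotent_of_mulEquiv (Subgroup.subgroupOfEquivOfLe (inf_le_inf_left P hle))
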